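/- Let $\mathbb K=\mathbb R$ or $\mathbb C$, and let $\mathbf u=(u_n)_{n\ge1}$ and $\mathbf v=(v_n)_{n\ge1}$ be two sequences of non-zero scalars in $\mathbb K$. For a sequence $\mathbf w=(w_n)_{n\ge 1}$ in $\mathbb K$, let $B_{\mathbf w}:\mathbb K^{\mathbb Z_+}\to\mathbb K^{\mathbb Z_+}$ be the weighted backward shift $(B_{\mathbf w}t)_n=w_{n+1}t_{n+1}$, $n\ge0$. Let $m_{\mathbf u}=\bigotimes_{n\ge0}\mu_{n,\mathbf u}$ and $m_{\mathbf v}=\bigotimes_{n\ge0}\mu_{n,\mathbf v}$ be two products of Borel probability measures on $\mathbb K$, respectively $B_{\mathbf u}$-invariant and $B_{\mathbf v}$-invariant, with $\mu_{0,\mathbf u}(\{0\})=0=\mu_{0,\mathbf v}(\{0\})$. Assume that $m_{\mathbf u}$ and $m_{\mathbf v}$ are not orthogonal (that is, not mutually singular), and let $$\lambda_n:=\frac{u_1\cdots u_n}{v_1\cdots v_n},\qquad n\ge1.$$ (1) If $a\in\mathbb K\setminus\{0\}$ is such that $\mu_{0,\mathbf v}(A)=\mu_{0,\mathbf u}(aA)$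 for every Borel set $A\subseteq\mathbb K$, then $\sum_{n=1}^\infty\bigl(1-|a^{-1}\lambda_n|\bigr)^2<\infty$. (2) If $\int_{\mathbb K\setminus\{0\}}(\log|t|)^2\,d\mu_{0,\mathbf u}(t)<\infty$ and $\int_{\mathbb K\setminus\{0\}}(\log|t|)^2\,d\mu_{0,\mathbf v}(t)<\infty$, then there exists $a\in\mathbb K\setminus\{0\}$ such that $\sum_{n=1}^\infty\bigl(1-|a^{-1}\lambda_n|\bigr)^2<\infty$. -/

import Mathlib

/-- The weighted backward shift `B_w` on the sequence space `𝕜^{ℤ₊}`: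
`(B_w t)_n = w_{n+1} t_{n+1}`.  A weight sequence is `(w_n)_{n ≥ 1}`; the entry `w 0` is unused. -/
def weightedShift {𝕜 : Type*} [Mul 𝕜] (w : ℕ → 𝕜) (t : ℕ → 𝕜) : ℕ → 𝕜 :=
  fun n => w (n + 1) * t (n + 1)

/-- The quotient `λ_n = (u_1 ⋯ u_n) / (v_1 ⋯ v_n)`. -/
def weightQuotient {𝕜 : Type*} [Field 𝕜] (u v : ℕ → 𝕜) (n : ℕ) : 𝕜 :=
  (∏ i ∈ Finset.Icc 1 n, u i) / (∏ i ∈ Finset.Icc 1 n, v i)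

open MeasureTheory ProbabilityTheory Filter Topology Set

/-! Write U_n = u_1⋯u_n. By invariance, U_n t_n has law μ_{0,u} under m_u, and the law of λ_n s with
s ~ μ_{0,v} under m_v. So log|U_n t_n| has a fixed law under the first measure, and under the second
the translate by log|λ_n| of a fixed law Q. Non-singular products force the mean differences of
uniformly bounded coordinate functions to be square summable. Test with arctan(log|U_n t|): the mean
of arctan under the translate of Q by c increases with c from -π/2 to π/2, at a rate bounded below
near any given c. If c matches the mean under μ_{0,u}, then min(|log|λ_n| - c|, 1) is square
summable, and exponentiating gives the claim with |a| = e^c. In (1) the scaling relation gives c =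
log|a|; in (2) the intermediate value theorem provides c. -/

/-- Chebyshev's inequality for a weighted sum of bounded functions of the coordinates under a
product measure. -/
theorem infinitePi_measure_abs_sub_ge_le {X : ℕ → Type*} [∀ n, MeasurableSpace (X n)]
    (μ : ∀ n, Measure (X n)) [∀ n, IsProbabilityMeasure (μ n)] (f : ∀ n, X n → ℝ)
    (hf : ∀ n, Measurable (f n)) {C : ℝ} (hC : ∀ n x, |f n x| ≤ C) (δ : ℕ → ℝ) (s : Finset ℕ)
    {c : ℝ} (hc : 0 < c) :
    Measure.infinitePi μ {t | c ≤ |∑ i ∈ s, δ i * f i (t i) - ∑ i ∈ s, δ i * ∫ x, f i x ∂(μ i)|} ≤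
      ENNReal.ofReal (C ^ 2 * (∑ i ∈ s, δ i ^ 2) / c ^ 2) := by
  set Y : ℕ → (∀ n, X n) → ℝ := fun i t => δ i * f i (t i) with hY
  have hYm : ∀ i, Measurable (Y i) := fun i =>
    ((hf i).comp (measurable_pi_apply i)).const_mul _
  have hYb : ∀ i t, |Y i t| ≤ |δ i| * C := fun i t => by
    rw [hY, abs_mul]
    exact mul_le_mul_of_nonneg_left (hC _ _) (abs_nonneg _)
  have hYL : ∀ i, MemLp (Y i) 2 (Measure.infinitePi μ) := fun i =>
    MemLp.of_bound (hYm i).aestronglyMeasurable _ (Eventually.of_forall (hYb i))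
  have hYE : ∀ i, ∫ t, Y i t ∂(Measure.infinitePi μ) = δ i * ∫ x, f i x ∂(μ i) := fun i => by
    have h := (measurePreserving_eval_infinitePi μ i)
    rw [hY, integral_const_mul, ← h.map_eq, integral_map h.measurable.aemeasurable
      (hf i).aestronglyMeasurable]
  have hind : iIndepFun Y (Measure.infinitePi μ) :=
    iIndepFun_infinitePi (P := μ) (X := fun i x => δ i * f i x) fun i => (hf i).const_mul _
  have hvar : variance (∑ i ∈ s, Y i) (Measure.infinitePi μ) ≤ C ^ 2 * ∑ i ∈ s, δ i ^ 2 := by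
    rw [IndepFun.variance_sum (fun i _ => hYL i) (fun i _ j _ hij => hind.indepFun hij),
      Finset.mul_sum]
    refine Finset.sum_le_sum fun i _ => ?_
    refine (variance_le_sq_of_bounded (a := -(|δ i| * C)) (b := |δ i| * C)
      (Eventually.of_forall fun t => abs_le.1 (hYb i t)) (hYm i).aemeasurable).trans_eq ?_
    rw [sub_neg_eq_add, add_self_div_two, mul_pow, sq_abs, mul_comm]
  have hS : MemLp (∑ i ∈ s, Y i) 2 (Measure.infinitePi μ) := memLp_finsetSum' _ fun i _ => hYL i
  have hmean : ∫ t, (∑ i ∈ s, Y i) t ∂(Measure.infinitePi μ) =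
      ∑ i ∈ s, δ i * ∫ x, f i x ∂(μ i) := by
    simp only [Finset.sum_apply]
    rw [integral_finsetSum _ fun i _ => (hYL i).integrable one_le_two]
    exact Finset.sum_congr rfl fun i _ => hYE i
  have h := meas_ge_le_variance_div_sq hS hc
  rw [hmean] at h
  simp only [Finset.sum_apply] at h
  exact h.trans (ENNReal.ofReal_le_ofReal (by gcongr))

/-- If two product measures are not mutually singular, then the differences of the means of
uniformly bounded functions of the coordinates are square summable. -/
theorem summable_sq_integral_sub_of_not_mutuallySingular {X : ℕ → Type*}
    [∀ n, MeasurableSpace (X n)] (μ ν : ∀ n, Measure (X n)) [∀ n, IsProbabilityMeasure (μ n)]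
    [∀ n, IsProbabilityMeasure (ν n)] (f : ∀ n, X n → ℝ) (hf : ∀ n, Measurable (f n)) {C : ℝ}
    (hC : ∀ n x, |f n x| ≤ C)
    (h : ¬ (Measure.infinitePi μ).MutuallySingular (Measure.infinitePi ν)) :
    Summable fun n => (∫ x, f n x ∂(μ n) - ∫ x, f n x ∂(ν n)) ^ 2 := by
  contrapose! h
  set δ : ℕ → ℝ := fun n => ∫ x, f n x ∂(μ n) - ∫ x, f n x ∂(ν n) with hδ
  have hD := (not_summable_iff_tendsto_nat_atTop_of_nonneg fun n => sq_nonneg (δ n)).1 h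
  refine Measure.mutuallySingular_of_disjoint ?_
  rw [disjoint_iff_inf_le]
  -- Singularity amounts to the largest common minorant having no mass.
  set ξ := Measure.infinitePi μ ⊓ Measure.infinitePi ν
  have hξμ := Measure.le_iff'.1 (inf_le_left : ξ ≤ Measure.infinitePi μ)
  have hξν := Measure.le_iff'.1 (inf_le_right : ξ ≤ Measure.infinitePi ν)
  suffices hξ : ξ univ = 0 by
    rw [Measure.measure_univ_eq_zero.1 hξ]
    exact bot_le
  set D : ℕ → ℝ := fun N => ∑ i ∈ Finset.range N, δ i ^ 2
  have hlim : Tendsto (fun N => ENNReal.ofReal (4 * C ^ 2 * (D N)⁻¹) +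
      ENNReal.ofReal (4 * C ^ 2 * (D N)⁻¹)) atTop (𝓝 0) := by
    have h0 : Tendsto (fun N => ENNReal.ofReal (4 * C ^ 2 * (D N)⁻¹)) atTop (𝓝 0) := by
      simpa using ENNReal.tendsto_ofReal ((tendsto_inv_atTop_zero.comp hD).const_mul (4 * C ^ 2))
    simpa using h0.add h0
  refine le_antisymm (ge_of_tendsto hlim ?_) zero_le
  filter_upwards [hD.eventually_gt_atTop 0] with N hN
  change 0 < D N at hN
  -- With the mean gaps δ as weights, the two means of the sum are `D N` apart while both variances
  -- are at most C² `D N`; Chebyshev at half the gap therefore gives O(1 / `D N`).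
  have hval : C ^ 2 * D N / (D N / 2) ^ 2 = 4 * C ^ 2 * (D N)⁻¹ := by
    field_simp
    ring
  have hμ := infinitePi_measure_abs_sub_ge_le μ f hf hC δ (Finset.range N) (half_pos hN)
  have hν := infinitePi_measure_abs_sub_ge_le ν f hf hC δ (Finset.range N) (half_pos hN)
  rw [hval] at hμ hν
  refine le_trans ?_ (add_le_add ((hξμ _).trans hμ)
    ((hξν _).trans hν))
  -- No point is within half the gap of both means, so the two deviation events cover the space.
  refine (measure_mono fun t _ => ?_).trans (measure_union_le _ _)
  by_contra hcon
  simp only [mem_union, mem_ofPred_eq, not_or, not_le] at hcon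
  have hdiff : ∑ i ∈ Finset.range N, δ i * ∫ x, f i x ∂(μ i) -
      ∑ i ∈ Finset.range N, δ i * ∫ x, f i x ∂(ν i) = D N := by
    rw [← Finset.sum_sub_distrib]
    exact Finset.sum_congr rfl fun i _ => by rw [← mul_sub, sq]
  have h1 := abs_lt.1 hcon.1
  have h2 := abs_lt.1 hcon.2
  linarith [h1.1, h2.2]

theorem Real.mul_sub_le_arctan_sub_arctan {M a b : ℝ} (hab : a ≤ b) (ha : |a| ≤ M) (hb : |b| ≤ M) :
    (1 + M ^ 2)⁻¹ * (b - a) ≤ Real.arctan b - Real.arctan a := by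
  refine (convex_Icc a b).mul_sub_le_image_sub_of_le_deriv Real.continuous_arctan.continuousOn
    Real.differentiable_arctan.differentiableOn (fun x hx => ?_) a (left_mem_Icc.2 hab) b
    (right_mem_Icc.2 hab) hab
  rw [interior_Icc] at hx
  simp only [Real.deriv_arctan, one_div]
  have hx2 : x ^ 2 ≤ M ^ 2 := by
    refine sq_le_sq' ?_ ?_
    · linarith [(abs_le.1 ha).1, hx.1]
    · linarith [(abs_le.1 hb).2, hx.2]
  gcongr

/-- Truncating the step at 1 keeps the segment in [-|x|-1, |x|+1], where arctan' is at least the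
stated constant. -/
theorem Real.mul_min_le_arctan_sub_arctan (x : ℝ) {d : ℝ} (hd : 0 ≤ d) :
    (1 + (|x| + 1) ^ 2)⁻¹ * min d 1 ≤ Real.arctan (x + d) - Real.arctan x ∧
    (1 + (|x| + 1) ^ 2)⁻¹ * min d 1 ≤ Real.arctan x - Real.arctan (x - d) := by
  have hm : 0 ≤ min d 1 := le_min hd zero_le_one
  have hm1 : |min d 1| ≤ 1 := by rw [abs_of_nonneg hm]; exact min_le_right _ _
  constructor
  · have h := Real.mul_sub_le_arctan_sub_arctan (M := |x| + 1) (le_add_of_nonneg_right hm)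
      (by linarith) ((abs_add_le x _).trans (by linarith))
    have h' := Real.arctan_strictMono.monotone (add_le_add_right (min_le_left d 1) x)
    rw [add_sub_cancel_left] at h
    linarith
  · have h := Real.mul_sub_le_arctan_sub_arctan (M := |x| + 1) (sub_le_self x hm)
      ((abs_sub x _).trans (by linarith)) (by linarith)
    have h' := Real.arctan_strictMono.monotone (sub_le_sub_left (min_le_left d 1) x)
    rw [sub_sub_cancel] at h
    linarith

theorem Real.abs_arctan_le_pi_div_two (x : ℝ) : |Real.arctan x| ≤ Real.pi / 2 :=
  abs_le.2 ⟨(Real.neg_pi_div_two_lt_arctan x).le, (Real.arctan_lt_pi_div_two x).le⟩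

theorem integrable_arctan_comp {α : Type*} [MeasurableSpace α] (μ : Measure α) [IsFiniteMeasure μ]
    {g : α → ℝ} (hg : Measurable g) : Integrable (fun x => Real.arctan (g x)) μ :=
  Integrable.of_bound (Real.measurable_arctan.comp hg).aestronglyMeasurable _
    (Eventually.of_forall fun _ => Real.abs_arctan_le_pi_div_two _)

theorem integral_arctan_comp_map {α β : Type*} [MeasurableSpace α] [MeasurableSpace β]
    (μ : Measure α) {g : α → β} (hg : Measurable g) {h : β → ℝ} (hh : Measurable h) :
    ∫ y, Real.arctan (h y) ∂(μ.map g) = ∫ x, Real.arctan (h (g x)) ∂μ :=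
  integral_map hg.aemeasurable (Real.measurable_arctan.comp hh).aestronglyMeasurable

theorem integral_pos_of_forall_pos {α : Type*} [MeasurableSpace α] {μ : Measure α} [NeZero μ]
    {φ : α → ℝ} (h0 : ∀ x, 0 < φ x) (hφ : Integrable φ μ) : 0 < ∫ x, φ x ∂μ := by
  have hsupp : Function.support φ = univ := eq_univ_of_forall fun x => (h0 x).ne'
  rw [integral_pos_iff_support_of_nonneg (fun x => (h0 x).le) hφ, hsupp]
  exact Measure.measure_univ_pos.2 (NeZero.ne μ)

/-- The mean of `arctan` moves at least linearly, up to saturation, under translations. -/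
theorem exists_mul_min_le_abs_integral_arctan_sub (Q : Measure ℝ) [IsProbabilityMeasure Q]
    (c : ℝ) : ∃ k : ℝ, 0 < k ∧ ∀ d : ℝ, k * min |d - c| 1 ≤
      |∫ y, Real.arctan (d + y) ∂Q - ∫ y, Real.arctan (c + y) ∂Q| := by
  set g : ℝ → ℝ := fun y => (1 + (|c + y| + 1) ^ 2)⁻¹ with hg
  have hg0 : ∀ y, 0 < g y := fun y => by positivity
  have hg1 : ∀ y, g y ≤ 1 := fun y => inv_le_one_of_one_le₀ (by nlinarith [sq_nonneg (|c + y| + 1)])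
  have hgi : Integrable g Q := by
    refine Integrable.of_bound (C := 1) (by fun_prop) (Eventually.of_forall fun y => ?_)
    rw [Real.norm_of_nonneg (hg0 y).le]
    exact hg1 y
  refine ⟨∫ y, g y ∂Q, integral_pos_of_forall_pos hg0 hgi, fun d => ?_⟩
  · have hi : ∀ e : ℝ, Integrable (fun y => Real.arctan (e + y)) Q := fun e =>
      integrable_arctan_comp Q (measurable_const.add measurable_id)
    rw [← integral_mul_const, ← integral_sub (hi d) (hi c)]
    rcases le_total c d with h | h
    · refine le_trans ?_ (le_abs_self _)
      refine integral_mono (hgi.mul_const _) ((hi d).sub (hi c)) fun y => ?_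
      have := (Real.mul_min_le_arctan_sub_arctan (c + y) (sub_nonneg.2 h)).1
      rw [show c + y + (d - c) = d + y by ring] at this
      simpa only [abs_of_nonneg (sub_nonneg.2 h)] using this
    · refine le_trans ?_ (neg_le_abs _)
      rw [← integral_neg]
      refine integral_mono (hgi.mul_const _) ((hi d).sub (hi c)).neg fun y => ?_
      have := (Real.mul_min_le_arctan_sub_arctan (c + y) (sub_nonneg.2 h)).2
      rw [show c + y - (c - d) = d + y by ring] at this
      simpa only [abs_sub_comm d c, abs_of_nonneg (sub_nonneg.2 h), neg_sub] using this

theorem abs_integral_arctan_lt {α : Type*} [MeasurableSpace α] (μ : Measure α)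
    [IsProbabilityMeasure μ] {g : α → ℝ} (hg : Measurable g) :
    |∫ x, Real.arctan (g x) ∂μ| < Real.pi / 2 := by
  have hi := integrable_arctan_comp μ hg
  have hc : Integrable (fun _ : α => Real.pi / 2) μ := integrable_const _
  have h1 := integral_pos_of_forall_pos (fun x => sub_pos.2 (Real.arctan_lt_pi_div_two (g x))) (hc.sub hi)
  have h2 := integral_pos_of_forall_pos (fun x => neg_lt_iff_pos_add'.1 (Real.neg_pi_div_two_lt_arctan (g x)))
    (hc.add hi)
  rw [integral_sub hc hi] at h1
  rw [integral_add hc hi] at h2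
  simp only [integral_const, probReal_univ, one_smul] at h1 h2
  exact abs_lt.2 ⟨by linarith, by linarith⟩

theorem tendsto_integral_arctan_add {ι : Type*} {l : Filter ι} [l.IsCountablyGenerated]
    (Q : Measure ℝ) [IsProbabilityMeasure Q] {c : ι → ℝ} {m : ℝ → ℝ}
    (h : ∀ y, Tendsto (fun i => Real.arctan (c i + y)) l (𝓝 (m y))) :
    Tendsto (fun i => ∫ y, Real.arctan (c i + y) ∂Q) l (𝓝 (∫ y, m y ∂Q)) :=
  tendsto_integral_filter_of_dominated_convergence (fun _ => Real.pi / 2)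
    (Eventually.of_forall fun _ =>
      (integrable_arctan_comp Q (measurable_const.add measurable_id)).aestronglyMeasurable)
    (Eventually.of_forall fun _ => Eventually.of_forall fun _ => Real.abs_arctan_le_pi_div_two _)
    (integrable_const _) (Eventually.of_forall h)

/-- Intermediate value theorem; dominated convergence gives continuity and the limits ±π/2. -/
theorem exists_integral_arctan_add_eq (Q : Measure ℝ) [IsProbabilityMeasure Q] {m : ℝ}
    (hm : |m| < Real.pi / 2) : ∃ c : ℝ, ∫ y, Real.arctan (c + y) ∂Q = m := by
  have hcont : Continuous fun c : ℝ => ∫ y, Real.arctan (c + y) ∂Q :=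
    continuous_iff_continuousAt.2 fun c => tendsto_integral_arctan_add Q fun y =>
      (Real.continuous_arctan.comp (continuous_id.add continuous_const)).continuousAt
  have htop : Tendsto (fun c : ℝ => ∫ y, Real.arctan (c + y) ∂Q) atTop (𝓝 (Real.pi / 2)) := by
    have := tendsto_integral_arctan_add (l := atTop) (c := id) Q (m := fun _ => Real.pi / 2)
      fun y => (tendsto_nhds_of_tendsto_nhdsWithin Real.tendsto_arctan_atTop).comp
        (tendsto_atTop_add_const_right _ y tendsto_id)
    simpa using this
  have hbot : Tendsto (fun c : ℝ => ∫ y, Real.arctan (c + y) ∂Q) atBot (𝓝 (-(Real.pi / 2))) := by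
    have := tendsto_integral_arctan_add (l := atBot) (c := id) Q (m := fun _ => -(Real.pi / 2))
      fun y => (tendsto_nhds_of_tendsto_nhdsWithin Real.tendsto_arctan_atBot).comp
        (tendsto_atBot_add_const_right _ y tendsto_id)
    simpa using this
  obtain ⟨h1, h2⟩ := abs_lt.1 hm
  exact mem_range_of_exists_le_of_exists_ge hcont
    ((hbot.eventually_lt_const h1).exists.imp fun _ => le_of_lt)
    ((htop.eventually_const_lt h2).exists.imp fun _ => le_of_lt)

theorem summable_one_sub_exp_sq {d : ℕ → ℝ} (h : Summable fun n => min |d n| 1 ^ 2) :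
    Summable fun n => (1 - Real.exp (d n)) ^ 2 := by
  refine Summable.of_norm_bounded_eventually_nat (h.mul_left 4) ?_
  filter_upwards [h.tendsto_atTop_zero.eventually_lt_const one_pos] with n hn
  have hn' : |d n| ≤ 1 := by
    by_contra! hcon
    rw [min_eq_right hcon.le] at hn
    norm_num at hn
  rw [min_eq_left hn', Real.norm_of_nonneg (sq_nonneg _), ← sq_abs, abs_sub_comm]
  calc |Real.exp (d n) - 1| ^ 2 ≤ (2 * |d n|) ^ 2 := by
        gcongr
        exact Real.abs_exp_sub_one_le hn'
    _ = 4 * |d n| ^ 2 := by ring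

/-- The marginals of a `B_w`-invariant product measure are rescaled copies of the first one. -/
theorem map_prod_mul_eq_of_measurePreserving_weightedShift {𝕜 : Type*} [RCLike 𝕜]
    [MeasurableSpace 𝕜] [BorelSpace 𝕜] {w : ℕ → 𝕜} {μ : ℕ → Measure 𝕜}
    [∀ n, IsProbabilityMeasure (μ n)]
    (h : MeasurePreserving (weightedShift w) (Measure.infinitePi μ) (Measure.infinitePi μ))
    (n : ℕ) : (μ n).map (fun t => (∏ i ∈ Finset.Icc 1 n, w i) * t) = μ 0 := by
  have hstep : ∀ n, (μ (n + 1)).map (fun t => w (n + 1) * t) = μ n := fun n => by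
    have h1 := ((measurePreserving_eval_infinitePi μ n).comp h).map_eq
    have h2 := measurePreserving_eval_infinitePi μ (n + 1)
    rw [← h2.map_eq, Measure.map_map (measurable_const_mul _) h2.measurable]
    exact h1
  induction n with
  | zero => simp
  | succ n ih =>
    rw [← ih, ← hstep n, Measure.map_map (measurable_const_mul _) (measurable_const_mul _),
      Finset.prod_Icc_succ_top (by omega)]
    simp only [Function.comp_def, mul_assoc]

/-- If `c = log ‖a‖` is the translation matching the means of `arctan ∘ log ‖·‖`, then
`a⁻¹ * weightQuotient u v` is close to `1` in modulus. -/
theorem summable_of_integral_arctan_log_eq {𝕜 : Type*} [RCLike 𝕜] [MeasurableSpace 𝕜]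
    [BorelSpace 𝕜] {u v : ℕ → 𝕜} (hu : ∀ n, 1 ≤ n → u n ≠ 0) (hv : ∀ n, 1 ≤ n → v n ≠ 0)
    {μu μv : ℕ → Measure 𝕜} [∀ n, IsProbabilityMeasure (μu n)] [∀ n, IsProbabilityMeasure (μv n)]
    (hinvu : MeasurePreserving (weightedShift u) (Measure.infinitePi μu) (Measure.infinitePi μu))
    (hinvv : MeasurePreserving (weightedShift v) (Measure.infinitePi μv) (Measure.infinitePi μv))
    (hv0 : μv 0 {0} = 0)
    (hnonorth : ¬ (Measure.infinitePi μu).MutuallySingular (Measure.infinitePi μv))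
    {a : 𝕜} (ha : a ≠ 0)
    (heq : ∫ t, Real.arctan (Real.log ‖t‖) ∂(μu 0) =
      ∫ t, Real.arctan (Real.log ‖a‖ + Real.log ‖t‖) ∂(μv 0)) :
    Summable (fun n : ℕ => (1 - ‖a⁻¹ * weightQuotient u v (n + 1)‖) ^ 2) := by
  have hlog : Measurable fun t : 𝕜 => Real.log ‖t‖ := measurable_norm.log
  set U : ℕ → 𝕜 := fun n => ∏ i ∈ Finset.Icc 1 n, u i
  set V : ℕ → 𝕜 := fun n => ∏ i ∈ Finset.Icc 1 n, v i
  have hU : ∀ n, U n ≠ 0 := fun n => Finset.prod_ne_zero_iff.2 fun i hi =>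
    hu i (Finset.mem_Icc.1 hi).1
  have hV : ∀ n, V n ≠ 0 := fun n => Finset.prod_ne_zero_iff.2 fun i hi =>
    hv i (Finset.mem_Icc.1 hi).1
  have hlam : ∀ n, weightQuotient u v n = U n / V n := fun n => rfl
  have hlam0 : ∀ n, weightQuotient u v n ≠ 0 := fun n => div_ne_zero (hU n) (hV n)
  set Q : Measure ℝ := (μv 0).map fun t => Real.log ‖t‖ with hQ
  have : IsProbabilityMeasure Q := Measure.isProbabilityMeasure_map hlog.aemeasurable
  have hQi : ∀ c, ∫ t, Real.arctan (c + Real.log ‖t‖) ∂(μv 0) = ∫ y, Real.arctan (c + y) ∂Q :=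
    fun c => (integral_arctan_comp_map _ hlog (measurable_const_add c)).symm
  have hfm : ∀ n, Measurable fun t : 𝕜 => Real.arctan (Real.log ‖U n * t‖) := fun n =>
    Real.measurable_arctan.comp (hlog.comp (measurable_const_mul _))
  have hsum := summable_sq_integral_sub_of_not_mutuallySingular μu μv
    (fun n t => Real.arctan (Real.log ‖U n * t‖)) hfm
    (fun n t => Real.abs_arctan_le_pi_div_two _) hnonorth
  have hEu : ∀ n, ∫ t, Real.arctan (Real.log ‖U n * t‖) ∂(μu n) =
      ∫ y, Real.arctan (Real.log ‖a‖ + y) ∂Q := fun n => by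
    rw [← hQi, ← heq, ← map_prod_mul_eq_of_measurePreserving_weightedShift hinvu n,
      integral_arctan_comp_map _ (measurable_const_mul _) hlog]
  have hEv : ∀ n, ∫ t, Real.arctan (Real.log ‖U n * t‖) ∂(μv n) =
      ∫ y, Real.arctan (Real.log ‖weightQuotient u v n‖ + y) ∂Q := fun n => by
    have h1 : ∫ t, Real.arctan (Real.log ‖U n * t‖) ∂(μv n) =
        ∫ t, Real.arctan (Real.log ‖weightQuotient u v n * t‖) ∂(μv 0) := by
      rw [← map_prod_mul_eq_of_measurePreserving_weightedShift hinvv n,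
        integral_arctan_comp_map _ (measurable_const_mul _)
          (h := fun t => Real.log ‖weightQuotient u v n * t‖)
          (hlog.comp (measurable_const_mul _))]
      refine integral_congr_ae (Eventually.of_forall fun t => ?_)
      change _ = Real.arctan (Real.log ‖weightQuotient u v n * (V n * t)‖)
      rw [hlam, ← mul_assoc, div_mul_cancel₀ _ (hV n)]
    rw [h1, ← hQi]
    refine integral_congr_ae ?_
    -- The log of the product splits only off t = 0, which is a null set.
    filter_upwards [measure_eq_zero_iff_ae_notMem.1 hv0] with t ht
    rw [norm_mul, Real.log_mul (norm_ne_zero_iff.2 (hlam0 n)) (norm_ne_zero_iff.2 ht)]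
  simp only [hEu, hEv] at hsum
  obtain ⟨k, hk, hkd⟩ := exists_mul_min_le_abs_integral_arctan_sub Q (Real.log ‖a‖)
  have hmin : Summable fun n =>
      min |Real.log ‖weightQuotient u v n‖ - Real.log ‖a‖| 1 ^ 2 := by
    refine Summable.of_nonneg_of_le (fun n => sq_nonneg _) (fun n => ?_) (hsum.mul_left (k ^ 2)⁻¹)
    rw [le_inv_mul_iff₀ (pow_pos hk 2), ← mul_pow, ← sq_abs (_ - _), abs_sub_comm (∫ _, _ ∂_)]
    exact pow_le_pow_left₀ (mul_nonneg hk.le (le_min (abs_nonneg _) zero_le_one)) (hkd _) 2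
  refine (summable_nat_add_iff (f := fun n => (1 - ‖a⁻¹ * weightQuotient u v n‖) ^ 2) 1).2 ?_
  refine (summable_one_sub_exp_sq hmin).congr fun n => ?_
  rw [Real.exp_sub, Real.exp_log (norm_pos_iff.2 (hlam0 n)), Real.exp_log (norm_pos_iff.2 ha),
    norm_mul, norm_inv, div_eq_inv_mul]

theorem theorem6p8 {𝕜 : Type*} [RCLike 𝕜] [MeasurableSpace 𝕜] [BorelSpace 𝕜]
    (u v : ℕ → 𝕜) (hu : ∀ n, 1 ≤ n → u n ≠ 0) (hv : ∀ n, 1 ≤ n → v n ≠ 0)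
    (μu μv : ℕ → MeasureTheory.Measure 𝕜)
    [∀ n, MeasureTheory.IsProbabilityMeasure (μu n)]
    [∀ n, MeasureTheory.IsProbabilityMeasure (μv n)]
    (hinvu : MeasureTheory.MeasurePreserving (weightedShift u)
      (MeasureTheory.Measure.infinitePi μu) (MeasureTheory.Measure.infinitePi μu))
    (hinvv : MeasureTheory.MeasurePreserving (weightedShift v)
      (MeasureTheory.Measure.infinitePi μv) (MeasureTheory.Measure.infinitePi μv))
    (hu0 : μu 0 {0} = 0) (hv0 : μv 0 {0} = 0)
    (hnonorth : ¬ (MeasureTheory.Measure.infinitePi μu).MutuallySingular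
      (MeasureTheory.Measure.infinitePi μv)) :
    (∀ a : 𝕜, a ≠ 0 →
      (∀ A : Set 𝕜, MeasurableSet A → μv 0 A = μu 0 ((fun t => a * t) '' A)) →
      Summable (fun n : ℕ => (1 - ‖a⁻¹ * weightQuotient u v (n + 1)‖) ^ 2)) ∧
    ((∫⁻ t in {0}ᶜ, ENNReal.ofReal (Real.log ‖t‖ ^ 2) ∂(μu 0)) < ⊤ →
      (∫⁻ t in {0}ᶜ, ENNReal.ofReal (Real.log ‖t‖ ^ 2) ∂(μv 0)) < ⊤ →
      ∃ a : 𝕜, a ≠ 0 ∧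
        Summable (fun n : ℕ => (1 - ‖a⁻¹ * weightQuotient u v (n + 1)‖) ^ 2)) := by
  have hlog : Measurable fun t : 𝕜 => Real.log ‖t‖ := measurable_norm.log
  constructor
  · intro a ha hA
    refine summable_of_integral_arctan_log_eq hu hv hinvu hinvv hv0 hnonorth ha ?_
    have hmap : (μv 0).map (fun t => a * t) = μu 0 := by
      ext B hB
      rw [Measure.map_apply (measurable_const_mul a) hB, hA _ (measurable_const_mul a hB),
        image_preimage_eq _ (mul_left_surjective₀ ha)]
    rw [← hmap, integral_arctan_comp_map _ (measurable_const_mul _) hlog]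
    refine integral_congr_ae ?_
    filter_upwards [measure_eq_zero_iff_ae_notMem.1 hv0] with t ht
    rw [norm_mul, Real.log_mul (norm_ne_zero_iff.2 ha) (norm_ne_zero_iff.2 ht)]
  · intro _ _
    have : IsProbabilityMeasure ((μv 0).map fun t => Real.log ‖t‖) :=
      Measure.isProbabilityMeasure_map hlog.aemeasurable
    obtain ⟨c, hc⟩ := exists_integral_arctan_add_eq ((μv 0).map fun t => Real.log ‖t‖)
      (abs_integral_arctan_lt (μu 0) hlog)
    -- Only |a| matters, so the positive scalar e^c serves.
    have ha : ((Real.exp c : ℝ) : 𝕜) ≠ 0 := RCLike.ofReal_ne_zero.2 (Real.exp_pos c).ne'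
    refine ⟨_, ha, summable_of_integral_arctan_log_eq hu hv hinvu hinvv hv0 hnonorth ha ?_⟩
    rw [RCLike.norm_ofReal, abs_of_pos (Real.exp_pos c), Real.log_exp, ← hc,
      integral_arctan_comp_map _ hlog (measurable_const_add c)]
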